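/- **Setting.** Let $L,T,K>0$, $1<\beta<2$, let $J,M,N\ge 1$ be integers, $h=L/M$, $\tau=T/N$, $x_i=ih$, $t_s=s\tau$. Put $m=2J$, $\Delta\alpha=\frac1{2J}$, $\alpha_r=r\,\Delta\alpha$ $(0\le r\le m)$. Let $\omega:[0,1]\to[0,\infty)$ satisfy $\omega(\alpha_r)>0$ for at least one $r<m$, and put $\lambda_r=d_r\,\omega(\alpha_r)\,\Delta\alpha$ with $d_0=d_m=\frac12$ and $d_r=1$ otherwise. Let $\sigma\in[\frac12,1]$ be the root of $$\sum_{r=0}^{m}\frac{\lambda_r}{\Gamma(3-\alpha_r)}\,\sigma^{1-\alpha_r}\Big[\sigma-\Big(1-\frac{\alpha_r}2\Big)\Big]\tau^{2-\alpha_r}=0 .$$ For $\alpha\in[0,1]$ let $$a_0^{(\alpha)}=\sigma^{1-\alpha},\qquad a_l^{(\alpha)}=(l+\sigma)^{1-\alpha}-(l-1+\sigma)^{1-\alpha}\quad(l\ge1),$$ $$b_l^{(\alpha)}=\frac{(l+\sigma)^{2-\alpha}-(l-1+\sigma)^{2-\alpha}}{2-\alpha}-\frac{(l+\sigma)^{1-\alpha}+(l-1+\sigma)^{1-\alpha}}2\quad(l\ge1).$$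 Let $c_0^{(1,\alpha)}=a_0^{(\alpha)}$ and, for $n\ge2$, $$c_0^{(n,\alpha)}=a_0^{(\alpha)}+b_1^{(\alpha)},\qquad c_k^{(n,\alpha)}=a_k^{(\alpha)}+b_{k+1}^{(\alpha)}-b_k^{(\alpha)}\ (1\le k\le n-2),\qquad c_{n-1}^{(n,\alpha)}=a_{n-1}^{(\alpha)}-b_{n-1}^{(\alpha)}.$$ Put $$\hat c_k^{(n)}=\sum_{r=0}^m\lambda_r\frac{\tau^{-\alpha_r}}{\Gamma(2-\alpha_r)}\,c_k^{(n,\alpha_r)},\qquad g_k^{(\beta)}=\frac{(-1)^k\,\Gamma(\beta+1)}{\Gamma(\frac\beta2-k+1)\,\Gamma(\frac\beta2+k+1)}\quad(k\in\mathbb Z),$$ $$c_*^{(\beta)}=\frac2\beta\,r_\beta,\qquad r_\beta=e^{-2}\,\frac{(4-\beta)(2-\beta)\beta}{(6+\beta)(4+\beta)(2+\beta)}\cdot\frac{\Gamma(\beta+1)}{\Gamma(\frac\beta2+1)^2}\Big(3+\frac\beta2\Big)^{\beta+1}.$$ For real functions $\phi$ and $f$ let $f_i^{n-1+\sigma}=f(x_i,t_{n-1+\sigma})$,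 and for grid functions $v$ let $\|v\|^2=h\sum_{i=1}^{M-1}v_i^2$. **Theorem (unconditional stability, one-dimensional case).** Let $\{u_i^n:\ 0\le i\le M,\ 0\le n\le N\}$ be real numbers that solve the difference scheme $$\sum_{k=0}^{n-1}\hat c_k^{(n)}\big(u_i^{n-k}-u_i^{n-k-1}\big)=-K h^{-\beta}\sum_{k=i-M}^{i}g_k^{(\beta)}\big[\sigma u_{i-k}^n+(1-\sigma)u_{i-k}^{n-1}\big]+f_i^{n-1+\sigma}\quad(1\le i\le M-1,\ 1\le n\le N),$$ $$u_0^n=u_M^n=0\quad(0\le n\le N),\qquad u_i^0=\phi(x_i)\quad(1\le i\le M-1).$$ Then, without any restriction on the step sizes $h,\tau,\Delta\alpha$, $$\|u^n\|^2\le\|u^0\|^2+\frac{(2L)^\beta}{K\,c_*^{(\beta)}\sum_{r=0}^m\frac{\lambda_r}{T^{\alpha_r}\,\Gamma(1-\alpha_r)}}\ \max_{1\le l\le n}\|f^{l-1+\sigma}\|^2,\qquad 1\le n\le N,$$ where the term $r=m$ (with $\alpha_m=1$) of the sum is $0$, because $1/\Gamma(0)=0$. -/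

import Mathlib

noncomputable section

namespace DistRiesz

/-- The node `α_r = r / (2J)` of the uniform grid on `[0, 1]`. -/
def node (J r : ℕ) : ℝ := (r : ℝ) / (2 * (J : ℝ))

/-- The weights `d_r` of the composite trapezoid formula: `1/2` at both ends, `1` inside. -/
def trapWeight (J r : ℕ) : ℝ := if r = 0 ∨ r = 2 * J then 1 / 2 else 1

/-- `λ_r = d_r ω(α_r) Δα`, with `Δα = 1 / (2J)`. -/
def lam (ω : ℝ → ℝ) (J r : ℕ) : ℝ := trapWeight J r * ω (node J r) * (1 / (2 * (J : ℝ)))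

/-- The function `F` whose positive root is the shift parameter `σ`. -/
def shiftFun (ω : ℝ → ℝ) (J : ℕ) (τ σ : ℝ) : ℝ :=
  ∑ r ∈ Finset.range (2 * J + 1),
    lam ω J r / Real.Gamma (3 - node J r) * σ ^ (1 - node J r) *
      (σ - (1 - node J r / 2)) * τ ^ (2 - node J r)

/-- `a_l^{(α)}`. -/
def coefA (σ α : ℝ) (l : ℕ) : ℝ :=
  if l = 0 then σ ^ (1 - α)
  else ((l : ℝ) + σ) ^ (1 - α) - ((l : ℝ) - 1 + σ) ^ (1 - α)

/-- `b_l^{(α)}`, used for `l ≥ 1` only. -/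
def coefB (σ α : ℝ) (l : ℕ) : ℝ :=
  1 / (2 - α) * (((l : ℝ) + σ) ^ (2 - α) - ((l : ℝ) - 1 + σ) ^ (2 - α)) -
    1 / 2 * (((l : ℝ) + σ) ^ (1 - α) + ((l : ℝ) - 1 + σ) ^ (1 - α))

/-- `c_k^{(n,α)}`, used for `0 ≤ k ≤ n - 1` only. -/
def coefC (σ α : ℝ) (n k : ℕ) : ℝ :=
  if n = 1 then coefA σ α 0
  else if k = 0 then coefA σ α 0 + coefB σ α 1
  else if k + 2 ≤ n then coefA σ α k + coefB σ α (k + 1) - coefB σ α k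
  else coefA σ α k - coefB σ α k

/-- `ĉ_k^{(n)}`, the coefficients of the interpolation approximation of
`∑ r, λ_r D_t^{α_r}` at the shifted time `t_{n-1+σ}`. -/
def coefHat (ω : ℝ → ℝ) (J : ℕ) (τ σ : ℝ) (n k : ℕ) : ℝ :=
  ∑ r ∈ Finset.range (2 * J + 1),
    lam ω J r * (τ ^ (-node J r) / Real.Gamma (2 - node J r)) * coefC σ (node J r) n k

/-- The fractional centred difference weights `g_k^{(β)}`. Since `Real.Gamma` vanishes at its poles
and `x / 0 = 0`, the convention `1 / Γ = 0` at the poles of `Γ` holds here. -/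
def gCoef (β : ℝ) (k : ℤ) : ℝ :=
  (-1 : ℝ) ^ k * Real.Gamma (β + 1) /
    (Real.Gamma (β / 2 - (k : ℝ) + 1) * Real.Gamma (β / 2 + (k : ℝ) + 1))

/-- `r_β`. -/
def rConst (β : ℝ) : ℝ :=
  Real.exp (-2) * ((4 - β) * (2 - β) * β / ((6 + β) * (4 + β) * (2 + β))) *
    (Real.Gamma (β + 1) / Real.Gamma (β / 2 + 1) ^ 2) * (3 + β / 2) ^ (β + 1)

/-- `c_*^{(β)} = (2 / β) r_β`. -/
def cStar (β : ℝ) : ℝ := 2 / β * rConst β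

/-- The discrete inner product `(v, w) = h ∑_{i=1}^{M-1} v_i w_i`. -/
def gridInner (h : ℝ) (M : ℕ) (v w : ℤ → ℝ) : ℝ :=
  h * ∑ i ∈ Finset.Icc (1 : ℤ) ((M : ℤ) - 1), v i * w i

/-- The discrete `L²` norm. -/
def gridNorm (h : ℝ) (M : ℕ) (v : ℤ → ℝ) : ℝ := Real.sqrt (gridInner h M v v)

/-- The samples `f_i^{n-1+σ} = f(x_i, t_{n-1+σ})`, with `x_i = i h` and
`t_{n-1+σ} = (n - 1 + σ) τ`. -/
def sourceGrid (f : ℝ → ℝ → ℝ) (h τ σ : ℝ) (n : ℕ) : ℤ → ℝ :=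
  fun i => f ((i : ℝ) * h) (((n : ℝ) - 1 + σ) * τ)

/-- `u n i = u_i^n` solves the difference scheme with `h = L / M`, `τ = T / N` and shift `σ`.
Only the values with `0 ≤ i ≤ M` and `0 ≤ n ≤ N` matter. -/
structure IsSchemeSolution (ω φ : ℝ → ℝ) (f : ℝ → ℝ → ℝ) (L T K β : ℝ) (J M N : ℕ) (σ : ℝ)
    (u : ℕ → ℤ → ℝ) : Prop where
  step : ∀ n : ℕ, 1 ≤ n → n ≤ N → ∀ i : ℤ, 1 ≤ i → i ≤ (M : ℤ) - 1 →
    ∑ k ∈ Finset.range n, coefHat ω J (T / N) σ n k * (u (n - k) i - u (n - k - 1) i) =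
      -K * (L / M) ^ (-β) *
          ∑ k ∈ Finset.Icc (i - (M : ℤ)) i,
            gCoef β k * (σ * u n (i - k) + (1 - σ) * u (n - 1) (i - k)) +
        sourceGrid f (L / M) (T / N) σ n i
  boundary_left : ∀ n : ℕ, n ≤ N → u n 0 = 0
  boundary_right : ∀ n : ℕ, n ≤ N → u n (M : ℤ) = 0
  initial : ∀ i : ℤ, 1 ≤ i → i ≤ (M : ℤ) - 1 → u 0 i = φ ((i : ℝ) * (L / M))

end DistRiesz

end

/-!
The proof is an energy method: test the scheme at level `n` with
`u^{n-1+σ} = σ u^n + (1-σ) u^{n-1}`.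

In time, Alikhanov's inequality turns the discrete fractional derivative of `u`, paired with
`u^{n-1+σ}`, into half the same operator applied to `‖u‖²`. It holds because the coefficients
decrease and `σ² ĉ_1 ≤ (2σ - 1) ĉ_0`. A single order satisfies the latter only up to a multiple of
`σ^{1-α} (σ - (1 - α/2))`, and the equation that defines `σ` says exactly that these defects cancel
in the sum over the orders.

In space, the matrix `g_{i-j}` is symmetric with nonpositive off-diagonal entries, so its quadratic
form is bounded below by its least row sum. The row sums telescope to tails of `∑ |g_k|`, which
decay no faster than `k^{-β}`.

Young's inequality absorbs the source into the coercive term, and the bound on `‖u^n‖²` follows by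
induction on `n`, since the last coefficient is at least half the sum of the
`λ_r / (T^{α_r} Γ(1 - α_r))`.
-/

namespace DistRiesz

open Finset

section DiscreteEnergy

theorem sub_le_sum_mul_sub_of_antitone {c y : ℕ → ℝ} {m : ℕ} (hc : ∀ k < m, c (k + 1) ≤ c k)
    (hy : ∀ k < m, 0 ≤ y (k + 1)) :
    c m * y (m + 1) - c 0 * y 0 ≤ ∑ k ∈ range (m + 1), c k * (y (k + 1) - y k) := by
  induction m with
  | zero => simp [mul_sub]
  | succ m ih =>
    have hlast := mul_le_mul_of_nonneg_right (hc m m.lt_succ_self) (hy m m.lt_succ_self)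
    have hinit := ih (fun k hk => hc k (by omega)) (fun k hk => hy k (by omega))
    rw [sum_range_succ]
    linarith

/-- The conditions on the weights `c 0, …, c m` under which the discrete derivative
`∑ k, c k * (v (m + 1 - k) - v (m - k))` is dissipative at the shifted level
`σ * v (m + 1) + (1 - σ) * v m`. For fractional derivatives only the first pair of weights feels
`σ`, so monotonicity is asked from `c 1` on. -/
structure IsAlikhanovKernel (σ μ : ℝ) (m : ℕ) (c : ℕ → ℝ) : Prop where
  le_last : μ ≤ c m
  succ_le : ∀ k, 1 ≤ k → k < m → c (k + 1) ≤ c k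
  sq_mul_one_le : 1 ≤ m → σ ^ 2 * c 1 ≤ (2 * σ - 1) * c 0

namespace IsAlikhanovKernel

variable {σ μ : ℝ} {m : ℕ} {c : ℕ → ℝ}

theorem last_le (hc : IsAlikhanovKernel σ μ m c) {k : ℕ} (hk : 1 ≤ k) (hkm : k ≤ m) :
    c m ≤ c k := by
  induction hkm using Nat.decreasingInduction with
  | self => exact le_rfl
  | of_succ k hkm ih => exact (ih (by omega)).trans (hc.succ_le k hk hkm)

theorem one_le_zero (hc : IsAlikhanovKernel σ μ m c) (hσ : 1 / 2 ≤ σ) (hμ : 0 < μ) (hm : 1 ≤ m) :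
    c 1 ≤ c 0 := by
  have hone : 0 < c 1 := hμ.trans_le (hc.le_last.trans (hc.last_le le_rfl hm))
  have hfirst := hc.sq_mul_one_le hm
  have hσ' : 0 < 2 * σ - 1 := by
    refine (by linarith : 0 ≤ 2 * σ - 1).lt_of_ne' fun h => ?_
    rw [h, zero_mul] at hfirst
    have : 0 < σ ^ 2 * c 1 := by positivity
    linarith
  refine le_of_mul_le_mul_left ?_ hσ'
  nlinarith [mul_nonneg (sq_nonneg (1 - σ)) hone.le]

theorem antitone (hc : IsAlikhanovKernel σ μ m c) (hσ : 1 / 2 ≤ σ) (hμ : 0 < μ) {k : ℕ}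
    (hk : k < m) : c (k + 1) ≤ c k := by
  rcases k.eq_zero_or_pos with rfl | hk0
  · exact hc.one_le_zero hσ hμ hk
  · exact hc.succ_le k hk0 hk

theorem zero_pos (hc : IsAlikhanovKernel σ μ m c) (hσ : 1 / 2 ≤ σ) (hμ : 0 < μ) : 0 < c 0 := by
  have hlast : 0 < c m := hμ.trans_le hc.le_last
  rcases m.eq_zero_or_pos with rfl | hm
  · exact hlast
  · exact (hlast.trans_le (hc.last_le le_rfl hm)).trans_le (hc.one_le_zero hσ hμ hm)

theorem le_of_sum_mul_sub_le (hc : IsAlikhanovKernel σ μ m c) (hσ : 1 / 2 ≤ σ) (hμ : 0 < μ)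
    {y : ℕ → ℝ} {B : ℝ} (hy : ∀ k ≤ m, y (k + 1) ≤ B)
    (hsum : ∑ k ∈ range (m + 1), c k * (y k - y (k + 1)) ≤ μ * (B - y (m + 1))) : y 0 ≤ B := by
  have hparts := sub_le_sum_mul_sub_of_antitone (c := c) (y := fun k => B - y k) (m := m)
    (fun k hk => hc.antitone hσ hμ hk) (fun k hk => sub_nonneg.mpr (hy k hk.le))
  simp only [sub_sub_sub_cancel_left] at hparts
  have hlast := mul_le_mul_of_nonneg_right hc.le_last (sub_nonneg.mpr (hy m le_rfl))
  exact sub_nonneg.mp (nonneg_of_mul_nonneg_right (by linarith) (hc.zero_pos hσ hμ))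

variable {E : Type*} [NormedAddCommGroup E] [InnerProductSpace ℝ E]

theorem half_sum_norm_sq_sub_le_inner (hc : IsAlikhanovKernel σ μ m c) (hσ : 1 / 2 ≤ σ)
    (hμ : 0 ≤ μ) (y : ℕ → E) :
    (∑ k ∈ range (m + 1), c k * (‖y k‖ ^ 2 - ‖y (k + 1)‖ ^ 2)) / 2 ≤
      inner ℝ (σ • y 0 + (1 - σ) • y 1) (∑ k ∈ range (m + 1), c k • (y k - y (k + 1))) := by
  set v := σ • y 0 + (1 - σ) • y 1 with hv
  have hpolar (a b : E) :
      inner ℝ v (a - b) = (‖a‖ ^ 2 - ‖b‖ ^ 2) / 2 + (‖v - b‖ ^ 2 - ‖v - a‖ ^ 2) / 2 := by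
    rw [norm_sub_sq_real, norm_sub_sq_real, inner_sub_right]
    ring
  have hsum : inner ℝ v (∑ k ∈ range (m + 1), c k • (y k - y (k + 1))) =
      (∑ k ∈ range (m + 1), c k * (‖y k‖ ^ 2 - ‖y (k + 1)‖ ^ 2)) / 2 +
        (∑ k ∈ range (m + 1), c k * (‖v - y (k + 1)‖ ^ 2 - ‖v - y k‖ ^ 2)) / 2 := by
    simp only [inner_sum, real_inner_smul_right, hpolar, mul_add, sum_add_distrib, sum_div,
      mul_div_assoc]
  have hzero : ‖v - y 0‖ ^ 2 = (1 - σ) ^ 2 * ‖y 0 - y 1‖ ^ 2 := by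
    rw [show v - y 0 = (σ - 1) • (y 0 - y 1) by rw [hv]; module, norm_smul, mul_pow,
      Real.norm_eq_abs, sq_abs, sub_sq_comm]
  have hone : ‖v - y 1‖ ^ 2 = σ ^ 2 * ‖y 0 - y 1‖ ^ 2 := by
    rw [show v - y 1 = σ • (y 0 - y 1) by rw [hv]; module, norm_smul, mul_pow,
      Real.norm_eq_abs, sq_abs]
  have hlast : 0 ≤ c m := hμ.trans hc.le_last
  rw [hsum]
  refine le_add_of_nonneg_right (div_nonneg ?_ two_pos.le)
  rw [sum_range_succ', hzero, hone]
  obtain _ | m := m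
  · rw [range_zero, sum_empty, zero_add, ← sub_mul,
      show σ ^ 2 - (1 - σ) ^ 2 = 2 * σ - 1 by ring]
    exact mul_nonneg hlast (mul_nonneg (by linarith) (sq_nonneg _))
  · have hparts := sub_le_sum_mul_sub_of_antitone (c := fun k => c (k + 1))
      (y := fun k => ‖v - y (k + 1)‖ ^ 2) (m := m)
      (fun k hk => hc.succ_le (k + 1) (by omega) (by omega)) (fun k _ => sq_nonneg _)
    have hfirst := mul_le_mul_of_nonneg_right (hc.sq_mul_one_le (by omega))
      (sq_nonneg ‖y 0 - y 1‖)
    have htail := mul_nonneg hlast (sq_nonneg ‖v - y (m + 1 + 1)‖)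
    simp only [zero_add, hone] at hparts
    linarith

theorem sum_mul_norm_sq_sub_le (hc : IsAlikhanovKernel σ μ m c) (hσ : 1 / 2 ≤ σ) (hμ : 0 ≤ μ)
    {κ : ℝ} (hκ : 0 < κ) {y : ℕ → E} {F D : E}
    (hstep : ∑ k ∈ range (m + 1), c k • (y k - y (k + 1)) = F - D)
    (hD : κ * ‖σ • y 0 + (1 - σ) • y 1‖ ^ 2 ≤ inner ℝ (σ • y 0 + (1 - σ) • y 1) D) :
    ∑ k ∈ range (m + 1), c k * (‖y k‖ ^ 2 - ‖y (k + 1)‖ ^ 2) ≤ ‖F‖ ^ 2 / (2 * κ) := by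
  have henergy := hc.half_sum_norm_sq_sub_le_inner hσ hμ y
  set v := σ • y 0 + (1 - σ) • y 1
  have hcauchy : inner ℝ v F ≤ ‖v‖ * ‖F‖ := real_inner_le_norm v F
  have hyoung : ‖v‖ * ‖F‖ ≤ κ * ‖v‖ ^ 2 + ‖F‖ ^ 2 / (2 * κ) / 2 := by
    have h : κ * ‖v‖ ^ 2 + ‖F‖ ^ 2 / (2 * κ) / 2 - ‖v‖ * ‖F‖ =
        (2 * κ * ‖v‖ - ‖F‖) ^ 2 / (4 * κ) := by
      field_simp
      ring
    rw [← sub_nonneg, h]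
    positivity
  rw [hstep, inner_sub_right] at henergy
  linarith

end IsAlikhanovKernel

variable {E : Type*} [NormedAddCommGroup E] [InnerProductSpace ℝ E]

theorem norm_sq_le_of_isAlikhanovKernel {σ μ κ G : ℝ} {c : ℕ → ℕ → ℝ} {u F D : ℕ → E} {n : ℕ}
    (hσ : 1 / 2 ≤ σ) (hμ : 0 < μ) (hκ : 0 < κ) (hG : 0 ≤ G)
    (hc : ∀ m < n, IsAlikhanovKernel σ μ m (c m))
    (hstep : ∀ m < n,
      ∑ k ∈ range (m + 1), c m k • (u (m + 1 - k) - u (m + 1 - k - 1)) = F m - D m)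
    (hD : ∀ m < n, κ * ‖σ • u (m + 1) + (1 - σ) • u m‖ ^ 2 ≤
      inner ℝ (σ • u (m + 1) + (1 - σ) • u m) (D m))
    (hF : ∀ m < n, ‖F m‖ ^ 2 ≤ G) :
    ‖u n‖ ^ 2 ≤ ‖u 0‖ ^ 2 + G / (2 * κ * μ) := by
  induction n using Nat.strong_induction_on with
  | _ n ih =>
    obtain _ | m := n
    · exact le_add_of_nonneg_right (by positivity)
    have hm := m.lt_succ_self
    refine (hc m hm).le_of_sum_mul_sub_le hσ hμ (y := fun k => ‖u (m + 1 - k)‖ ^ 2)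
      (fun k hk => ih (m + 1 - (k + 1)) (by omega) (fun l hl => hc l (by omega))
        (fun l hl => hstep l (by omega)) (fun l hl => hD l (by omega))
        (fun l hl => hF l (by omega))) ?_
    calc ∑ k ∈ range (m + 1), c m k * (‖u (m + 1 - k)‖ ^ 2 - ‖u (m + 1 - (k + 1))‖ ^ 2)
        ≤ ‖F m‖ ^ 2 / (2 * κ) :=
          (hc m hm).sum_mul_norm_sq_sub_le hσ hμ.le hκ (y := fun k => u (m + 1 - k))
            (hstep m hm) (hD m hm)
      _ ≤ G / (2 * κ) := by gcongr; exact hF m hm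
      _ = μ * (‖u 0‖ ^ 2 + G / (2 * κ * μ) - ‖u (m + 1 - (m + 1))‖ ^ 2) := by
          rw [Nat.sub_self, add_sub_cancel_left]
          field_simp

end DiscreteEnergy

section RealPower

theorem rpow_le_rpow_mul_tangent {p x y : ℝ} (hp0 : 0 ≤ p) (hp1 : p ≤ 1) (hx : 0 < x)
    (hy : 0 ≤ y) : y ^ p ≤ x ^ p * ((x + p * (y - x)) / x) := by
  have hbernoulli := rpow_one_add_le_one_add_mul_self (s := (y - x) / x)
    (by rw [le_div_iff₀ hx]; linarith) hp0 hp1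
  rw [show 1 + (y - x) / x = y / x by field_simp; ring, Real.div_rpow hy hx.le,
    div_le_iff₀' (Real.rpow_pos_of_pos hx p)] at hbernoulli
  exact hbernoulli.trans_eq (by field_simp)

theorem convexOn_rpow_of_nonpos {p : ℝ} (hp : p ≤ 0) :
    ConvexOn ℝ (Set.Ioi 0) fun x : ℝ => x ^ p := by
  refine ⟨convex_Ioi 0, fun x hx y hy a b ha hb hab => ?_⟩
  have hlog := mul_le_mul_of_nonpos_right
    (strictConcaveOn_log_Ioi.concaveOn.2 hx hy ha hb hab) hp
  calc (a • x + b • y) ^ p = Real.exp (Real.log (a • x + b • y) * p) :=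
        Real.rpow_def_of_pos (convex_Ioi 0 hx hy ha hb hab) p
    _ ≤ Real.exp (a • (Real.log x * p) + b • (Real.log y * p)) :=
        Real.exp_le_exp.mpr (hlog.trans_eq (by simp only [smul_eq_mul]; ring))
    _ ≤ a • Real.exp (Real.log x * p) + b • Real.exp (Real.log y * p) :=
        convexOn_exp.2 (Set.mem_univ _) (Set.mem_univ _) ha hb hab
    _ = a • x ^ p + b • y ^ p := by rw [Real.rpow_def_of_pos hx, Real.rpow_def_of_pos hy]

theorem trapezoid_le_integral_of_concaveOn {f : ℝ → ℝ} {a b : ℝ} (hab : a < b)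
    (hf : ConcaveOn ℝ (Set.Icc a b) f) (hint : IntervalIntegrable f MeasureTheory.volume a b) :
    (b - a) * ((f a + f b) / 2) ≤ ∫ x in a..b, f x := by
  have hba : 0 < b - a := sub_pos.mpr hab
  have hchord (x : ℝ) (hx : x ∈ Set.Icc a b) : f a + (f b - f a) / (b - a) * (x - a) ≤ f x := by
    have h := hf.2 (Set.left_mem_Icc.mpr hab.le) (Set.right_mem_Icc.mpr hab.le)
      (div_nonneg (sub_nonneg.mpr hx.2) hba.le) (div_nonneg (sub_nonneg.mpr hx.1) hba.le)
      (by field_simp; ring)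
    simp only [smul_eq_mul] at h
    rw [show (b - x) / (b - a) * a + (x - a) / (b - a) * b = x by field_simp; ring] at h
    exact h.trans_eq' (by field_simp; ring)
  calc (b - a) * ((f a + f b) / 2) = ∫ x in a..b, (f a + (f b - f a) / (b - a) * (x - a)) := by
        rw [intervalIntegral.integral_add (by simp)
            (Continuous.intervalIntegrable (by fun_prop) a b),
          intervalIntegral.integral_const_mul,
          intervalIntegral.integral_comp_sub_right (fun x => x)]
        simp only [intervalIntegral.integral_const, integral_id, smul_eq_mul]
        field_simp
        ring
    _ ≤ ∫ x in a..b, f x :=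
        intervalIntegral.integral_mono_on hab.le
          (Continuous.intervalIntegrable (by fun_prop) a b) hint hchord

/-- The second forward difference of `f` with unit step. -/
def secondDifference (f : ℝ → ℝ) (x : ℝ) : ℝ := f (x + 2) - 2 * f (x + 1) + f x

theorem antitoneOn_secondDifference {f f' : ℝ → ℝ} (hf : ∀ x > 0, HasDerivAt f (f' x) x)
    (hf' : ConcaveOn ℝ (Set.Ioi 0) f') :
    AntitoneOn (secondDifference f) (Set.Ioi 0) := by
  have hderiv (x : ℝ) (hx : 0 < x) : HasDerivAt (secondDifference f) (secondDifference f' x) x :=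
    (((hf (x + 2) (by linarith)).comp_add_const x 2).sub
      (((hf (x + 1) (by linarith)).comp_add_const x 1).const_mul 2)).add (hf x hx)
  refine antitoneOn_of_hasDerivWithinAt_nonpos (convex_Ioi 0)
    (fun x hx => (hderiv x hx).continuousAt.continuousWithinAt)
    (fun x hx => (hderiv x (interior_subset hx)).hasDerivWithinAt) fun x hx => ?_
  have hx : 0 < x := interior_subset hx
  have hmid := hf'.2 (Set.mem_Ioi.mpr hx) (Set.mem_Ioi.mpr (by linarith : 0 < x + 2))
    one_half_pos.le one_half_pos.le (add_halves 1)
  simp only [smul_eq_mul] at hmid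
  rw [show 1 / 2 * x + 1 / 2 * (x + 2) = x + 1 by ring] at hmid
  rw [secondDifference]
  linarith

theorem three_point_remainder_nonneg {p σ : ℝ} (hp0 : 0 ≤ p) (hp1 : p ≤ 1) (hσ : 1 / 2 ≤ σ) :
    0 ≤ (2 * σ + 1) * (σ + p) - (p - (2 * σ - 1)) * (σ + 1) ^ 2 := by
  have hzero : 0 ≤ (2 * σ + 1) * σ + (2 * σ - 1) * (σ + 1) ^ 2 := by
    have : 0 ≤ 2 * σ - 1 := by linarith
    positivity
  have hone : 0 ≤ (σ + 1) * (2 * σ ^ 2 + 2 * σ - 1) := by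
    have : 0 ≤ 2 * σ ^ 2 + 2 * σ - 1 := by nlinarith
    positivity
  calc (0 : ℝ)
      ≤ (1 - p) * ((2 * σ + 1) * σ + (2 * σ - 1) * (σ + 1) ^ 2) +
        p * ((σ + 1) * (2 * σ ^ 2 + 2 * σ - 1)) :=
        add_nonneg (mul_nonneg (sub_nonneg.mpr hp1) hzero) (mul_nonneg hp0 hone)
    _ = (2 * σ + 1) * (σ + p) - (p - (2 * σ - 1)) * (σ + 1) ^ 2 := by ring

theorem three_point_rpow_le {p σ : ℝ} (hp0 : 0 ≤ p) (hp1 : p ≤ 1) (hσ : 1 / 2 ≤ σ) :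
    σ ^ 2 * ((σ + 2) ^ p * (2 * σ + 3 - p)) + (σ + 1) ^ 2 * (σ ^ p * (2 * σ - 1 - p)) ≤
      (2 * σ ^ 2 + 2 * σ - 1) * ((σ + 1) ^ p * (2 * σ + 1 - p)) := by
  have hσ0 : 0 < σ := by linarith
  have hσ1 : 0 < σ + 1 := by linarith
  have : 0 ≤ 1 - p := sub_nonneg.mpr hp1
  have hright : (σ + 2) ^ p ≤ (σ + 1) ^ p * ((σ + 1 + p) / (σ + 1)) :=
    (rpow_le_rpow_mul_tangent hp0 hp1 hσ1 (by linarith)).trans_eq (by ring)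
  have hleft : σ ^ p ≤ (σ + 1) ^ p * ((σ + 1 - p) / (σ + 1)) :=
    (rpow_le_rpow_mul_tangent hp0 hp1 hσ1 hσ0.le).trans_eq (by ring)
  have hleft' : (σ + 1) ^ p * (σ / (σ + p)) ≤ σ ^ p := by
    have htangent := rpow_le_rpow_mul_tangent hp0 hp1 hσ0 hσ1.le
    rw [add_sub_cancel_left, mul_one, mul_div_assoc', le_div_iff₀ hσ0] at htangent
    rwa [mul_div_assoc', div_le_iff₀ (by linarith)]
  -- The sign of `2 * σ - 1 - p` decides whether the upper bound `hleft` for `σ ^ p`, from the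
  -- tangent at `σ + 1`, or the lower bound `hleft'`, from the tangent at `σ`, is the useful one.
  rcases le_total 0 (2 * σ - 1 - p) with hsign | hsign
  · calc σ ^ 2 * ((σ + 2) ^ p * (2 * σ + 3 - p)) + (σ + 1) ^ 2 * (σ ^ p * (2 * σ - 1 - p))
        ≤ σ ^ 2 * ((σ + 1) ^ p * ((σ + 1 + p) / (σ + 1)) * (2 * σ + 3 - p)) +
          (σ + 1) ^ 2 * ((σ + 1) ^ p * ((σ + 1 - p) / (σ + 1)) * (2 * σ - 1 - p)) := by
          gcongr
          linarith
      _ = (2 * σ ^ 2 + 2 * σ - 1) * ((σ + 1) ^ p * (2 * σ + 1 - p)) -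
          (σ + 1) ^ p * (p * (1 - p) * (2 * σ + 1)) / (σ + 1) := by
          field_simp
          ring
      _ ≤ (2 * σ ^ 2 + 2 * σ - 1) * ((σ + 1) ^ p * (2 * σ + 1 - p)) :=
          sub_le_self _ (by positivity)
  · have hremainder := three_point_remainder_nonneg hp0 hp1 hσ
    calc σ ^ 2 * ((σ + 2) ^ p * (2 * σ + 3 - p)) + (σ + 1) ^ 2 * (σ ^ p * (2 * σ - 1 - p))
        ≤ σ ^ 2 * ((σ + 1) ^ p * ((σ + 1 + p) / (σ + 1)) * (2 * σ + 3 - p)) +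
          (σ + 1) ^ 2 * ((σ + 1) ^ p * (σ / (σ + p)) * (2 * σ - 1 - p)) := by
          have := mul_le_mul_of_nonpos_right hleft' hsign
          gcongr
          linarith
      _ = (2 * σ ^ 2 + 2 * σ - 1) * ((σ + 1) ^ p * (2 * σ + 1 - p)) -
          (σ + 1) ^ p * (p * (1 - p) *
            ((2 * σ + 1) * (σ + p) - (p - (2 * σ - 1)) * (σ + 1) ^ 2)) /
              ((σ + 1) * (σ + p)) := by
          field_simp
          ring
      _ ≤ (2 * σ ^ 2 + 2 * σ - 1) * ((σ + 1) ^ p * (2 * σ + 1 - p)) :=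
          sub_le_self _ (by positivity)

end RealPower

section SingleOrder

/-- A function whose unit differences give the coefficients `c_k^{(n,α)}`: a primitive of
`x ^ (1 - α)` corrected by the trapezoid term of `coefB`. -/
noncomputable def kernelPrimitive (α x : ℝ) : ℝ := x ^ (2 - α) / (2 - α) - x ^ (1 - α) / 2

variable {α σ : ℝ}

theorem kernelPrimitive_eq {x : ℝ} (hα : α ≤ 1) (hx : 0 < x) :
    kernelPrimitive α x = x ^ (1 - α) * (2 * x - 2 + α) / (2 * (2 - α)) := by
  have : 2 - α ≠ 0 := by linarith
  rw [kernelPrimitive, show 2 - α = 1 - α + 1 by ring, Real.rpow_add_one hx.ne']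
  have : 1 - α + 1 ≠ 0 := by linarith
  field_simp
  ring

theorem hasDerivAt_kernelPrimitive {x : ℝ} (hα : α ≤ 1) (hx : 0 < x) :
    HasDerivAt (kernelPrimitive α) (x ^ (1 - α) - (1 - α) / 2 * x ^ (-α)) x := by
  have : 2 - α ≠ 0 := by linarith
  refine (((Real.hasDerivAt_rpow_const (p := 2 - α) (Or.inl hx.ne')).div_const (2 - α)).sub
    ((Real.hasDerivAt_rpow_const (p := 1 - α) (Or.inl hx.ne')).div_const 2)).congr_deriv ?_
  rw [show 2 - α - 1 = 1 - α by ring, show 1 - α - 1 = -α by ring]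
  field_simp

theorem antitoneOn_secondDifference_kernelPrimitive (hα : α ∈ Set.Icc 0 1) :
    AntitoneOn (secondDifference (kernelPrimitive α)) (Set.Ioi 0) := by
  refine antitoneOn_secondDifference (fun x hx => hasDerivAt_kernelPrimitive hα.2 hx) ?_
  have hpow := (Real.concaveOn_rpow (p := 1 - α) (by linarith [hα.2]) (by linarith [hα.1])).subset
    Set.Ioi_subset_Ici_self (convex_Ioi 0)
  exact hpow.sub ((convexOn_rpow_of_nonpos (neg_nonpos.mpr hα.1)).smul
    (div_nonneg (sub_nonneg.mpr hα.2) two_pos.le))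

theorem three_point_kernelPrimitive_le (hα : α ∈ Set.Icc 0 1) (hσ : 1 / 2 ≤ σ) :
    σ ^ 2 * kernelPrimitive α (σ + 2) + (σ + 1) ^ 2 * kernelPrimitive α σ ≤
      (2 * σ ^ 2 + 2 * σ - 1) * kernelPrimitive α (σ + 1) := by
  have hα' : 0 < 2 * (2 - α) := by linarith [hα.2]
  have hpow := three_point_rpow_le (p := 1 - α) (by linarith [hα.2]) (by linarith [hα.1]) hσ
  rw [kernelPrimitive_eq hα.2 (by linarith), kernelPrimitive_eq hα.2 (by linarith),
    kernelPrimitive_eq hα.2 (by linarith)]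
  refine (le_of_eq ?_).trans ((div_le_div_of_nonneg_right hpow hα'.le).trans_eq ?_) <;> ring

theorem coefB_eq_integral_sub (hα : α ≤ 1) (l : ℕ) :
    coefB σ α l = (∫ x in ((l : ℝ) - 1 + σ)..(l + σ), x ^ (1 - α)) -
      (((l : ℝ) - 1 + σ) ^ (1 - α) + (l + σ) ^ (1 - α)) / 2 := by
  rw [integral_rpow (Or.inl (by linarith)), coefB, show 1 - α + 1 = 2 - α by ring]
  ring

theorem coefB_nonneg (hα : α ∈ Set.Icc 0 1) (hσ : 0 ≤ σ) {l : ℕ} (hl : 1 ≤ l) :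
    0 ≤ coefB σ α l := by
  have hl' : (1 : ℝ) ≤ l := by exact_mod_cast hl
  have hconcave := (Real.concaveOn_rpow (p := 1 - α) (by linarith [hα.2])
    (by linarith [hα.1])).subset
      (Set.Icc_subset_Ici_self.trans (Set.Ici_subset_Ici.mpr (by linarith : 0 ≤ (l : ℝ) - 1 + σ)))
      (convex_Icc _ (l + σ))
  have htrapezoid := trapezoid_le_integral_of_concaveOn (by linarith) hconcave
    (intervalIntegral.intervalIntegrable_rpow' (by linarith [hα.2]))
  rw [coefB_eq_integral_sub hα.2]
  linarith

theorem le_coefA_sub_coefB (hα : α ∈ Set.Icc 0 1) (hσ : 0 ≤ σ) {l : ℕ} (hl : 1 ≤ l) :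
    (1 - α) / 2 * ((l : ℝ) + σ) ^ (-α) ≤ coefA σ α l - coefB σ α l := by
  have hl' : (1 : ℝ) ≤ l := by exact_mod_cast hl
  have hlσ : 0 < (l : ℝ) + σ := by linarith
  have hintegral : ∫ x in ((l : ℝ) - 1 + σ)..(l + σ), x ^ (1 - α) ≤ ((l : ℝ) + σ) ^ (1 - α) := by
    calc ∫ x in ((l : ℝ) - 1 + σ)..(l + σ), x ^ (1 - α)
        ≤ ∫ _ in ((l : ℝ) - 1 + σ)..(l + σ), ((l : ℝ) + σ) ^ (1 - α) := by
          refine intervalIntegral.integral_mono_on (by linarith)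
            (intervalIntegral.intervalIntegrable_rpow' (by linarith [hα.2])) (by simp)
            fun x hx => Real.rpow_le_rpow ?_ hx.2 (by linarith [hα.2])
          linarith [hx.1]
      _ = ((l : ℝ) + σ) ^ (1 - α) := by
          rw [intervalIntegral.integral_const, smul_eq_mul]
          ring
  have htangent := rpow_le_rpow_mul_tangent (p := 1 - α) (by linarith [hα.2])
    (by linarith [hα.1]) hlσ (by linarith : 0 ≤ (l : ℝ) - 1 + σ)
  have hexpand : ((l : ℝ) + σ) ^ (1 - α) * ((l + σ + (1 - α) * (l - 1 + σ - (l + σ))) / (l + σ)) =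
      ((l : ℝ) + σ) ^ (1 - α) - (1 - α) * (l + σ) ^ (-α) := by
    rw [sub_eq_neg_add 1 α, Real.rpow_add_one hlσ.ne']
    field_simp
    ring
  rw [coefB_eq_integral_sub hα.2, coefA, if_neg (by omega)]
  linarith

theorem coefC_zero {n : ℕ} (hn : 2 ≤ n) :
    coefC σ α n 0 = kernelPrimitive α (σ + 1) - kernelPrimitive α σ := by
  simp only [coefC, if_neg (show n ≠ 1 by omega), if_true, coefA, coefB, kernelPrimitive]
  norm_num
  rw [add_comm 1 σ]
  ring

theorem coefA_add_coefB_succ_sub_coefB {k : ℕ} (hk : 1 ≤ k) :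
    coefA σ α k + coefB σ α (k + 1) - coefB σ α k =
      secondDifference (kernelPrimitive α) (k - 1 + σ) := by
  simp only [coefA, coefB, secondDifference, kernelPrimitive, if_neg (show k ≠ 0 by omega)]
  push_cast
  rw [show (k : ℝ) - 1 + σ + 2 = k + 1 + σ by ring, show (k : ℝ) - 1 + σ + 1 = k + σ by ring,
    add_sub_cancel_right]
  ring

theorem coefC_eq_secondDifference {n k : ℕ} (hk : 1 ≤ k) (hkn : k + 2 ≤ n) :
    coefC σ α n k = secondDifference (kernelPrimitive α) (k - 1 + σ) := by
  rw [coefC, if_neg (by omega), if_neg (by omega), if_pos hkn, coefA_add_coefB_succ_sub_coefB hk]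

theorem coefC_le_secondDifference (hα : α ∈ Set.Icc 0 1) (hσ : 0 ≤ σ) {n k : ℕ}
    (hk : 1 ≤ k) (hkn : k < n) :
    coefC σ α n k ≤ secondDifference (kernelPrimitive α) (k - 1 + σ) := by
  rw [← coefA_add_coefB_succ_sub_coefB hk, coefC, if_neg (by omega), if_neg (by omega)]
  have := coefB_nonneg hα hσ (by omega : 1 ≤ k + 1)
  split_ifs <;> linarith

theorem coefC_succ_le (hα : α ∈ Set.Icc 0 1) (hσ : 0 < σ) {n k : ℕ} (hk : 1 ≤ k)
    (hkn : k + 1 < n) : coefC σ α n (k + 1) ≤ coefC σ α n k := by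
  have hk' : (1 : ℝ) ≤ k := by exact_mod_cast hk
  rw [coefC_eq_secondDifference hk (by omega)]
  refine (coefC_le_secondDifference hα hσ.le (by omega) hkn).trans
    (antitoneOn_secondDifference_kernelPrimitive hα ?_ ?_ ?_)
  · exact Set.mem_Ioi.mpr (by linarith)
  · exact Set.mem_Ioi.mpr (by push_cast; linarith)
  · push_cast; linarith

theorem le_coefC_last (hα : α ∈ Set.Icc 0 1) (hσ : 1 / 2 ≤ σ) (m : ℕ) :
    (1 - α) / 2 * ((m : ℝ) + σ) ^ (-α) ≤ coefC σ α (m + 1) m := by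
  have hσ0 : 0 < σ := by linarith
  rcases m.eq_zero_or_pos with rfl | hm
  · rw [coefC, if_pos rfl, coefA, if_pos rfl, Nat.cast_zero, zero_add, sub_eq_neg_add 1 α,
      Real.rpow_add_one hσ0.ne', mul_comm]
    exact mul_le_mul_of_nonneg_left (by linarith [hα.1]) (Real.rpow_nonneg hσ0.le _)
  · rw [coefC, if_neg (by omega), if_neg (by omega), if_neg (by omega)]
    exact le_coefA_sub_coefB hα hσ0.le hm

end SingleOrder

section MultiTerm

theorem inv_Gamma_one_sub (α : ℝ) :
    (Real.Gamma (1 - α))⁻¹ = (1 - α) / Real.Gamma (2 - α) := by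
  rcases eq_or_ne α 1 with rfl | hα
  · simp
  · have hα' : 1 - α ≠ 0 := sub_ne_zero.mpr hα.symm
    rw [show 2 - α = 1 - α + 1 by ring, Real.Gamma_add_one hα', div_mul_cancel_left₀ hα']

variable {ι : Type*} {s : Finset ι} {w α : ι → ℝ} {τ σ T : ℝ}

/-- The factor of `c_k^{(n,α_r)}` in the discretization, with time step `τ`, of the term
`w_r D_t^{α_r}`. -/
noncomputable def scaledWeight (w α : ι → ℝ) (τ : ℝ) (r : ι) : ℝ :=
  w r * (τ ^ (-α r) / Real.Gamma (2 - α r))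

/-- The coefficients of the discretization of `∑ r ∈ s, w_r D_t^{α_r}`; `coefHat` is the case of
the trapezoid nodes and weights. -/
noncomputable def multiTermCoef (s : Finset ι) (w α : ι → ℝ) (τ σ : ℝ) (n k : ℕ) : ℝ :=
  ∑ r ∈ s, scaledWeight w α τ r * coefC σ (α r) n k

/-- The function of `σ` whose root is the shift parameter; `shiftFun` is the case of the trapezoid
nodes and weights. -/
noncomputable def multiTermShiftFun (s : Finset ι) (w α : ι → ℝ) (τ σ : ℝ) : ℝ :=
  ∑ r ∈ s, w r / Real.Gamma (3 - α r) * σ ^ (1 - α r) * (σ - (1 - α r / 2)) * τ ^ (2 - α r)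

/-- The value at time `T` of the operator `∑ r ∈ s, w_r D_t^{α_r}` of Riemann–Liouville
derivatives on the constant `1`; it measures the coercivity of the operator on `[0, T]`. The terms
with `α_r = 1` vanish, since `Real.Gamma 0 = 0` and `x / 0 = 0`. -/
noncomputable def multiTermRate (s : Finset ι) (w α : ι → ℝ) (T : ℝ) : ℝ :=
  ∑ r ∈ s, w r / (T ^ α r * Real.Gamma (1 - α r))

theorem scaledWeight_nonneg {r : ι} (hw : 0 ≤ w r) (hα : α r ≤ 1) (hτ : 0 ≤ τ) :
    0 ≤ scaledWeight w α τ r :=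
  mul_nonneg hw (div_nonneg (Real.rpow_nonneg hτ _)
    (Real.Gamma_nonneg_of_nonneg (by linarith)))

theorem multiTermRate_pos (hw : ∀ r ∈ s, 0 ≤ w r) (hα : ∀ r ∈ s, α r ≤ 1)
    (hex : ∃ r ∈ s, α r < 1 ∧ 0 < w r) (hT : 0 < T) : 0 < multiTermRate s w α T := by
  refine sum_pos' (fun r hr => div_nonneg (hw r hr) (mul_nonneg (Real.rpow_nonneg hT.le _)
    (Real.Gamma_nonneg_of_nonneg (sub_nonneg.mpr (hα r hr))))) ?_
  obtain ⟨r, hr, hαr, hwr⟩ := hex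
  exact ⟨r, hr, div_pos hwr (mul_pos (Real.rpow_pos_of_pos hT _)
    (Real.Gamma_pos_of_pos (sub_pos.mpr hαr)))⟩

theorem sum_scaledWeight_mul_kernelPrimitive_eq_zero (hα : ∀ r ∈ s, α r ≤ 1) (hτ : 0 < τ)
    (hσ : 0 < σ) (hroot : multiTermShiftFun s w α τ σ = 0) :
    ∑ r ∈ s, scaledWeight w α τ r * kernelPrimitive (α r) σ = 0 := by
  have hscaled : τ ^ 2 * ∑ r ∈ s, scaledWeight w α τ r * kernelPrimitive (α r) σ = 0 := by
    rw [← hroot, multiTermShiftFun, mul_sum]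
    refine sum_congr rfl fun r hr => ?_
    have hα2 : 2 - α r ≠ 0 := by linarith [hα r hr]
    have hΓ := Real.Gamma_pos_of_pos (by linarith [hα r hr] : 0 < 2 - α r)
    rw [kernelPrimitive_eq (hα r hr) hσ, scaledWeight, show 3 - α r = 2 - α r + 1 by ring,
      Real.Gamma_add_one hα2, sub_eq_add_neg 2 (α r), Real.rpow_add hτ, Real.rpow_two,
      ← sub_eq_add_neg]
    field_simp
    ring
  exact (mul_eq_zero.mp hscaled).resolve_left (by positivity)

theorem multiTermCoef_succ_le (hw : ∀ r ∈ s, 0 ≤ w r) (hα : ∀ r ∈ s, α r ∈ Set.Icc 0 1)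
    (hτ : 0 ≤ τ) (hσ : 0 < σ) {n k : ℕ} (hk : 1 ≤ k) (hkn : k + 1 < n) :
    multiTermCoef s w α τ σ n (k + 1) ≤ multiTermCoef s w α τ σ n k :=
  sum_le_sum fun r hr => mul_le_mul_of_nonneg_left (coefC_succ_le (hα r hr) hσ hk hkn)
    (scaledWeight_nonneg (hw r hr) (hα r hr).2 hτ)

theorem sq_mul_multiTermCoef_one_le (hw : ∀ r ∈ s, 0 ≤ w r) (hα : ∀ r ∈ s, α r ∈ Set.Icc 0 1)
    (hτ : 0 < τ) (hσ : 1 / 2 ≤ σ) (hroot : multiTermShiftFun s w α τ σ = 0) {n : ℕ}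
    (hn : 2 ≤ n) :
    σ ^ 2 * multiTermCoef s w α τ σ n 1 ≤ (2 * σ - 1) * multiTermCoef s w α τ σ n 0 := by
  have hσ0 : 0 < σ := by linarith
  have hzero := sum_scaledWeight_mul_kernelPrimitive_eq_zero (fun r hr => (hα r hr).2) hτ hσ0 hroot
  -- Each order satisfies the inequality up to a multiple of `kernelPrimitive (α r) σ`; these
  -- multiples cancel in the sum because `σ` is the root.
  have horder (r : ι) (hr : r ∈ s) : σ ^ 2 * coefC σ (α r) n 1 ≤
      (2 * σ - 1) * coefC σ (α r) n 0 - 2 * kernelPrimitive (α r) σ := by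
    have hone := mul_le_mul_of_nonneg_left
      (coefC_le_secondDifference (hα r hr) hσ0.le le_rfl (by omega : 1 < n)) (sq_nonneg σ)
    have hthree := three_point_kernelPrimitive_le (hα r hr) hσ
    rw [secondDifference, Nat.cast_one, sub_self, zero_add] at hone
    rw [coefC_zero hn]
    linarith
  calc σ ^ 2 * multiTermCoef s w α τ σ n 1
      = ∑ r ∈ s, scaledWeight w α τ r * (σ ^ 2 * coefC σ (α r) n 1) := by
        rw [multiTermCoef, mul_sum]
        exact sum_congr rfl fun r _ => by ring
    _ ≤ ∑ r ∈ s, scaledWeight w α τ r *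
          ((2 * σ - 1) * coefC σ (α r) n 0 - 2 * kernelPrimitive (α r) σ) :=
        sum_le_sum fun r hr => mul_le_mul_of_nonneg_left (horder r hr)
          (scaledWeight_nonneg (hw r hr) (hα r hr).2 hτ.le)
    _ = (2 * σ - 1) * multiTermCoef s w α τ σ n 0 -
          2 * ∑ r ∈ s, scaledWeight w α τ r * kernelPrimitive (α r) σ := by
        rw [multiTermCoef, mul_sum, mul_sum, ← sum_sub_distrib]
        exact sum_congr rfl fun r _ => by ring
    _ = (2 * σ - 1) * multiTermCoef s w α τ σ n 0 := by rw [hzero, mul_zero, sub_zero]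

theorem half_multiTermRate_le_multiTermCoef_last (hw : ∀ r ∈ s, 0 ≤ w r)
    (hα : ∀ r ∈ s, α r ∈ Set.Icc 0 1) (hτ : 0 < τ) (hσ : σ ∈ Set.Icc (1 / 2) 1) {m : ℕ}
    (hmT : (m + 1) * τ ≤ T) :
    multiTermRate s w α T / 2 ≤ multiTermCoef s w α τ σ (m + 1) m := by
  have hmσ : 0 < (m : ℝ) + σ := by linarith [hσ.1, m.cast_nonneg (α := ℝ)]
  have htime : τ * (m + σ) ≤ T := by nlinarith [hσ.2]
  have hT : 0 < T := (mul_pos hτ hmσ).trans_le htime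
  rw [multiTermRate, sum_div]
  refine sum_le_sum fun r hr => ?_
  have hweight := scaledWeight_nonneg (hw r hr) (hα r hr).2 hτ.le
  have hconst : 0 ≤ w r * ((1 - α r) / Real.Gamma (2 - α r)) / 2 :=
    div_nonneg (mul_nonneg (hw r hr) (div_nonneg (sub_nonneg.mpr (hα r hr).2)
      (Real.Gamma_nonneg_of_nonneg (by linarith [(hα r hr).2])))) two_pos.le
  calc w r / (T ^ α r * Real.Gamma (1 - α r)) / 2
      = w r * ((1 - α r) / Real.Gamma (2 - α r)) / 2 * T ^ (-α r) := by
        rw [← inv_Gamma_one_sub, Real.rpow_neg hT.le]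
        ring
    _ ≤ w r * ((1 - α r) / Real.Gamma (2 - α r)) / 2 * (τ * (m + σ)) ^ (-α r) :=
        mul_le_mul_of_nonneg_left (Real.rpow_le_rpow_of_nonpos (mul_pos hτ hmσ) htime
          (neg_nonpos.mpr (hα r hr).1)) hconst
    _ = scaledWeight w α τ r * ((1 - α r) / 2 * ((m : ℝ) + σ) ^ (-α r)) := by
        rw [scaledWeight, Real.mul_rpow hτ.le hmσ.le]
        ring
    _ ≤ scaledWeight w α τ r * coefC σ (α r) (m + 1) m :=
        mul_le_mul_of_nonneg_left (le_coefC_last (hα r hr) hσ.1 m) hweight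

theorem isAlikhanovKernel_multiTermCoef (hw : ∀ r ∈ s, 0 ≤ w r)
    (hα : ∀ r ∈ s, α r ∈ Set.Icc 0 1) (hτ : 0 < τ) (hσ : σ ∈ Set.Icc (1 / 2) 1)
    (hroot : multiTermShiftFun s w α τ σ = 0) {m : ℕ} (hmT : (m + 1) * τ ≤ T) :
    IsAlikhanovKernel σ (multiTermRate s w α T / 2) m (multiTermCoef s w α τ σ (m + 1)) where
  le_last := half_multiTermRate_le_multiTermCoef_last hw hα hτ hσ hmT
  succ_le _ hk hkm := multiTermCoef_succ_le hw hα hτ.le (by linarith [hσ.1]) hk (by omega)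
  sq_mul_one_le hm := sq_mul_multiTermCoef_one_le hw hα hτ hσ.1 hroot (by omega)

end MultiTerm

section RieszWeights

variable {β : ℝ}

theorem gCoef_neg (β : ℝ) (k : ℤ) : gCoef β (-k) = gCoef β k := by
  have hsign : (-1 : ℝ) ^ (-k) = (-1 : ℝ) ^ k := by rw [zpow_neg, ← inv_zpow, inv_neg_one]
  rw [gCoef, gCoef, hsign, Int.cast_neg, sub_neg_eq_add, ← sub_eq_add_neg,
    mul_comm (Real.Gamma (β / 2 + k + 1))]

theorem half_ne_intCast (hβ : β ∈ Set.Ioo 0 2) (j : ℤ) : β / 2 ≠ j := by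
  intro h
  have hpos : (0 : ℝ) < j := by linarith [hβ.1]
  have hlt : (j : ℝ) < 1 := by linarith [hβ.2]
  norm_cast at hpos hlt
  omega

theorem gCoef_succ (hβ : β ∈ Set.Ioo 0 2) (k : ℤ) :
    (k + 1 + β / 2) * gCoef β (k + 1) = (k - β / 2) * gCoef β k := by
  have hsub : β / 2 - k ≠ 0 := sub_ne_zero.mpr (half_ne_intCast hβ k)
  have hadd : β / 2 + k + 1 ≠ 0 := fun h =>
    half_ne_intCast hβ (-k - 1) (by push_cast; linarith)
  have hΓsub : Real.Gamma (β / 2 - k) ≠ 0 := Real.Gamma_ne_zero fun m h =>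
    half_ne_intCast hβ (k - m) (by push_cast; linarith)
  have hΓadd : Real.Gamma (β / 2 + k + 1) ≠ 0 := Real.Gamma_ne_zero fun m h =>
    half_ne_intCast hβ (-k - 1 - m) (by push_cast; linarith)
  rw [gCoef, gCoef, Int.cast_add, Int.cast_one,
    show β / 2 - ((k : ℝ) + 1) + 1 = β / 2 - k by ring, Real.Gamma_add_one hsub,
    show β / 2 + ((k : ℝ) + 1) + 1 = β / 2 + k + 1 + 1 by ring, Real.Gamma_add_one hadd,
    zpow_add_one₀ (by norm_num), show (k : ℝ) + 1 + β / 2 = β / 2 + k + 1 by ring,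
    show (k : ℝ) - β / 2 = -(β / 2 - k) by ring]
  generalize β / 2 - (k : ℝ) = p at *
  generalize β / 2 + (k : ℝ) + 1 = q at *
  field_simp

theorem gCoef_zero (β : ℝ) : gCoef β 0 = Real.Gamma (β + 1) / Real.Gamma (β / 2 + 1) ^ 2 := by
  simp only [gCoef, zpow_zero, Int.cast_zero, sub_zero, add_zero, one_mul, sq]

theorem gCoef_zero_pos (hβ : -1 < β) : 0 < gCoef β 0 := by
  rw [gCoef_zero]
  exact div_pos (Real.Gamma_pos_of_pos (by linarith))
    (pow_pos (Real.Gamma_pos_of_pos (by linarith)) 2)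

theorem gCoef_natCast_neg (hβ : β ∈ Set.Ioo 0 2) {k : ℕ} (hk : 1 ≤ k) : gCoef β k < 0 := by
  obtain ⟨hβ0, hβ2⟩ := hβ
  induction k, hk using Nat.le_induction with
  | base =>
    have hrec := gCoef_succ ⟨hβ0, hβ2⟩ 0
    have hzero := gCoef_zero_pos (by linarith : -1 < β)
    simp only [Int.cast_zero, zero_add, zero_sub] at hrec
    rw [Nat.cast_one]
    by_contra! hnonneg
    nlinarith
  | succ k hk ih =>
    have hrec := gCoef_succ ⟨hβ0, hβ2⟩ k
    have hk' : (1 : ℝ) ≤ k := by exact_mod_cast hk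
    push_cast at hrec ⊢
    by_contra! hnonneg
    nlinarith

theorem gCoef_nonpos (hβ : β ∈ Set.Ioo 0 2) {k : ℤ} (hk : k ≠ 0) : gCoef β k ≤ 0 := by
  rcases Int.natAbs_eq k with h | h
  · rw [h]
    exact (gCoef_natCast_neg hβ (by omega)).le
  · rw [h, gCoef_neg]
    exact (gCoef_natCast_neg hβ (by omega)).le

/-- A discrete antiderivative of `β g_k^{(β)}`, which evaluates the partial sums of the weights in
closed form. For `k ≥ 1` it is `β` times the tail `∑_{j ≥ k} |g_j^{(β)}|`. -/
noncomputable def gTail (β : ℝ) (k : ℤ) : ℝ := -((k : ℝ) + β / 2) * gCoef β k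

theorem gTail_succ (hβ : β ∈ Set.Ioo 0 2) (k : ℤ) :
    gTail β (k + 1) = -(k - β / 2) * gCoef β k := by
  rw [gTail, Int.cast_add, Int.cast_one]
  linarith [gCoef_succ hβ k]

theorem gTail_succ_sub (hβ : β ∈ Set.Ioo 0 2) (k : ℤ) :
    gTail β (k + 1) - gTail β k = β * gCoef β k := by
  rw [gTail_succ hβ, gTail]
  ring

theorem gTail_neg (hβ : β ∈ Set.Ioo 0 2) (k : ℤ) : gTail β (-k) = -gTail β (k + 1) := by
  rw [gTail_succ hβ, gTail, gCoef_neg, Int.cast_neg]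
  ring

theorem mul_sum_gCoef_sub (hβ : β ∈ Set.Ioo 0 2) (i : ℤ) (n : ℕ) :
    β * ∑ j ∈ Icc (1 : ℤ) n, gCoef β (i - j) = gTail β i - gTail β (i - n) := by
  induction n with
  | zero => simp
  | succ n ih =>
    have hIcc : Icc (1 : ℤ) (n + 1) = insert ((n : ℤ) + 1) (Icc (1 : ℤ) n) := by
      ext j
      simp only [mem_Icc, mem_insert]
      omega
    rw [Nat.cast_add, Nat.cast_one, hIcc, sum_insert (by simp), mul_add, ih, ← gTail_succ_sub hβ,
      show i - ((n : ℤ) + 1) + 1 = i - n by ring]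
    ring

theorem mul_sum_gCoef_row (hβ : β ∈ Set.Ioo 0 2) (i : ℤ) {M : ℕ} (hM : 1 ≤ M) :
    β * ∑ j ∈ Icc (1 : ℤ) ((M : ℤ) - 1), gCoef β (i - j) = gTail β i + gTail β (M - i) := by
  have hsum := mul_sum_gCoef_sub hβ i (M - 1)
  rw [Nat.cast_sub hM, Nat.cast_one] at hsum
  rw [hsum, show i - ((M : ℤ) - 1) = -((M : ℤ) - i - 1) by ring, gTail_neg hβ, sub_add_cancel,
    sub_neg_eq_add]

theorem gTail_natCast_pos (hβ : β ∈ Set.Ioo 0 2) {k : ℕ} (hk : 1 ≤ k) : 0 < gTail β k := by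
  have hfactor : 0 < (k : ℝ) + β / 2 := by linarith [hβ.1, k.cast_nonneg (α := ℝ)]
  rw [gTail, Int.cast_natCast]
  exact mul_pos_of_neg_of_neg (neg_neg_of_pos hfactor) (gCoef_natCast_neg hβ hk)

theorem gTail_natCast_le (hβ : β ∈ Set.Ioo 0 2) {k l : ℕ} (hk : 1 ≤ k) (hkl : k ≤ l) :
    gTail β l ≤ gTail β k := by
  induction l, hkl using Nat.le_induction with
  | base => exact le_rfl
  | succ l hkl ih =>
    have hstep := gTail_succ_sub hβ l
    have hneg := mul_neg_of_pos_of_neg hβ.1 (gCoef_natCast_neg hβ (hk.trans hkl))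
    push_cast
    linarith

theorem sub_one_rpow_mul_le (hβ : β ∈ Set.Ioo 0 2) {x : ℝ} (hx : 1 ≤ x) :
    (x - 1) ^ β * (x + β / 2) ≤ x ^ β * (x - β / 2) := by
  obtain ⟨hβ0, hβ2⟩ := hβ
  have hx0 : 0 < x := by linarith
  have hsq {y : ℝ} (hy : 0 ≤ y) : (y ^ (β / 2)) ^ 2 = y ^ β := by
    rw [← Real.rpow_mul_natCast hy, Nat.cast_ofNat, div_mul_cancel₀ _ two_ne_zero]
  have htangent := rpow_le_rpow_mul_tangent (by linarith : 0 ≤ β / 2) (by linarith) hx0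
    (sub_nonneg.mpr hx)
  calc (x - 1) ^ β * (x + β / 2)
      = ((x - 1) ^ (β / 2)) ^ 2 * (x + β / 2) := by rw [hsq (sub_nonneg.mpr hx)]
    _ ≤ (x ^ (β / 2) * ((x + β / 2 * (x - 1 - x)) / x)) ^ 2 * (x + β / 2) := by
        have := Real.rpow_nonneg (sub_nonneg.mpr hx) (β / 2)
        gcongr
    _ = x ^ β * (x - β / 2) * (1 - (β / 2 / x) ^ 2) := by
        rw [mul_pow, hsq hx0.le]
        field_simp
        ring
    _ ≤ x ^ β * (x - β / 2) :=
        mul_le_of_le_one_right (mul_nonneg (Real.rpow_nonneg hx0.le _) (by linarith))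
          (sub_le_self _ (sq_nonneg _))

theorem monotone_rpow_mul_gTail (hβ : β ∈ Set.Ioo 0 2) :
    Monotone fun k : ℕ => (k : ℝ) ^ β * gTail β (k + 1) := by
  refine monotone_nat_of_le_succ fun k => ?_
  have hneg := gCoef_natCast_neg hβ (Nat.le_add_left 1 k)
  have hratio := sub_one_rpow_mul_le hβ (le_add_of_nonneg_left k.cast_nonneg : (1 : ℝ) ≤ k + 1)
  rw [add_sub_cancel_right] at hratio
  rw [gTail_succ hβ (k + 1 : ℕ), gTail]
  push_cast at hneg ⊢
  linarith [mul_le_mul_of_nonneg_right hratio (neg_nonneg.mpr hneg.le)]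

theorem rConst_eq (hβ : β ∈ Set.Ioo 0 2) :
    rConst β = Real.exp (-2) * gTail β 3 * (3 + β / 2) ^ β := by
  obtain ⟨hβ0, hβ2⟩ := hβ
  have hone := gCoef_succ ⟨hβ0, hβ2⟩ 0
  have htwo := gCoef_succ ⟨hβ0, hβ2⟩ 1
  have hthree := gTail_succ ⟨hβ0, hβ2⟩ 2
  norm_num at hone htwo hthree
  have hgone : gCoef β 1 = -(β / 2) * gCoef β 0 / (1 + β / 2) := by
    rw [eq_div_iff (by linarith)]
    linarith
  have hgtwo : gCoef β 2 = (1 - β / 2) * gCoef β 1 / (1 + 1 + β / 2) := by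
    rw [eq_div_iff (by linarith)]
    linarith
  rw [hthree, hgtwo, hgone, rConst, ← gCoef_zero, Real.rpow_add_one (by linarith)]
  field_simp
  ring

theorem rConst_pos (hβ : β ∈ Set.Ioo 0 2) : 0 < rConst β := by
  have htail : 0 < gTail β 3 := gTail_natCast_pos hβ (k := 3) (by norm_num)
  have hbase : 0 < 3 + β / 2 := by linarith [hβ.1]
  rw [rConst_eq hβ]
  positivity

theorem cStar_pos (hβ : β ∈ Set.Ioo 0 2) : 0 < cStar β :=
  mul_pos (div_pos two_pos hβ.1) (rConst_pos hβ)

theorem rConst_mul_le_gTail (hβ : β ∈ Set.Ioo 0 2) {k M : ℕ} (hk : 1 ≤ k) (hkM : k < M) :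
    rConst β * (2 * (M : ℝ)) ^ (-β) ≤ gTail β k := by
  have htail : 0 < gTail β 3 := gTail_natCast_pos hβ (k := 3) (by norm_num)
  have hM : (0 : ℝ) < M := by exact_mod_cast (by omega : 0 < M)
  have hexp : Real.exp (-2) ≤ 1 := Real.exp_le_one_iff.mpr (by norm_num)
  have hbase : (0 : ℝ) ≤ 3 + β / 2 ∧ 3 + β / 2 ≤ 2 * 2 := by
    constructor <;> linarith [hβ.1, hβ.2]
  have hmono : (2 : ℝ) ^ β * gTail β 3 ≤ (M : ℝ) ^ β * gTail β (M + 1) := by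
    have := monotone_rpow_mul_gTail hβ (by omega : 2 ≤ M)
    norm_num at this
    exact this
  calc rConst β * (2 * (M : ℝ)) ^ (-β)
      = Real.exp (-2) * gTail β 3 * (3 + β / 2) ^ β * (2 * (M : ℝ)) ^ (-β) := by rw [rConst_eq hβ]
    _ ≤ 1 * gTail β 3 * (2 * 2) ^ β * (2 * (M : ℝ)) ^ (-β) := by
        gcongr
        exacts [Real.rpow_nonneg hbase.1 _, hbase.1, hβ.1.le, hbase.2]
    _ = (2 : ℝ) ^ β * gTail β 3 * (M : ℝ) ^ (-β) := by
        rw [Real.mul_rpow two_pos.le two_pos.le, Real.mul_rpow two_pos.le hM.le,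
          Real.rpow_neg two_pos.le]
        field_simp
    _ ≤ (M : ℝ) ^ β * gTail β (M + 1) * (M : ℝ) ^ (-β) := by gcongr
    _ = gTail β (M + 1 : ℕ) := by
        rw [Real.rpow_neg hM.le, mul_right_comm, mul_inv_cancel₀ (by positivity), one_mul]
        push_cast
        rfl
    _ ≤ gTail β k := gTail_natCast_le hβ hk (by omega)

theorem cStar_mul_le_sum_gCoef_row (hβ : β ∈ Set.Ioo 0 2) {M : ℕ} {i : ℤ}
    (hi : i ∈ Icc (1 : ℤ) ((M : ℤ) - 1)) :
    cStar β * (2 * (M : ℝ)) ^ (-β) ≤ ∑ j ∈ Icc (1 : ℤ) ((M : ℤ) - 1), gCoef β (i - j) := by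
  obtain ⟨hi1, hiM⟩ := mem_Icc.mp hi
  obtain ⟨k, rfl⟩ := Int.eq_ofNat_of_zero_le (by omega : 0 ≤ i)
  have hβ0 : β ≠ 0 := hβ.1.ne'
  have hleft := rConst_mul_le_gTail hβ (k := k) (M := M) (by omega) (by omega)
  have hright := rConst_mul_le_gTail hβ (k := M - k) (M := M) (by omega) (by omega)
  rw [Nat.cast_sub (by omega)] at hright
  refine le_of_mul_le_mul_left ?_ hβ.1
  calc β * (cStar β * (2 * (M : ℝ)) ^ (-β))
      = rConst β * (2 * (M : ℝ)) ^ (-β) + rConst β * (2 * (M : ℝ)) ^ (-β) := by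
        rw [cStar]
        field_simp
        ring
    _ ≤ gTail β k + gTail β (M - k) := add_le_add hleft hright
    _ = β * ∑ j ∈ Icc (1 : ℤ) ((M : ℤ) - 1), gCoef β (k - j) :=
        (mul_sum_gCoef_row hβ _ (by omega)).symm

end RieszWeights

section Coercivity

theorem mul_sum_sq_le_of_le_row_sum {ι : Type*} {s : Finset ι} {a : ι → ι → ℝ} {κ : ℝ}
    (hsymm : ∀ i ∈ s, ∀ j ∈ s, a i j = a j i) (hoff : ∀ i ∈ s, ∀ j ∈ s, i ≠ j → a i j ≤ 0)
    (hrow : ∀ i ∈ s, κ ≤ ∑ j ∈ s, a i j) (v : ι → ℝ) :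
    κ * ∑ i ∈ s, v i ^ 2 ≤ ∑ i ∈ s, v i * ∑ j ∈ s, a i j * v j := by
  have hswap : ∑ i ∈ s, ∑ j ∈ s, a i j * v j ^ 2 = ∑ i ∈ s, ∑ j ∈ s, a i j * v i ^ 2 := by
    rw [sum_comm]
    exact sum_congr rfl fun i hi => sum_congr rfl fun j hj => by rw [hsymm j hj i hi]
  calc κ * ∑ i ∈ s, v i ^ 2
      ≤ ∑ i ∈ s, ∑ j ∈ s, a i j * v i ^ 2 := by
        rw [mul_sum]
        refine sum_le_sum fun i hi => ?_
        rw [← sum_mul]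
        exact mul_le_mul_of_nonneg_right (hrow i hi) (sq_nonneg _)
    _ = ∑ i ∈ s, ∑ j ∈ s, a i j * ((v i ^ 2 + v j ^ 2) / 2) := by
        simp only [add_div, mul_add, ← mul_div_assoc, sum_add_distrib, ← sum_div]
        rw [hswap, add_halves]
    _ ≤ ∑ i ∈ s, ∑ j ∈ s, v i * (a i j * v j) := by
        refine sum_le_sum fun i hi => sum_le_sum fun j hj => ?_
        rcases eq_or_ne i j with rfl | hij
        · linarith
        · linarith [mul_nonneg (neg_nonneg.mpr (hoff i hi j hj hij)) (sq_nonneg (v i - v j))]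
    _ = ∑ i ∈ s, v i * ∑ j ∈ s, a i j * v j := by simp only [mul_sum]

variable {β h : ℝ} {M : ℕ}

/-- Minus the fractional centred difference approximation of the Riesz derivative of order `β`,
applied to the grid function that agrees with `v` at the interior nodes `1, …, M - 1` and vanishes
at the other nodes. -/
noncomputable def discreteRiesz (β h : ℝ) (M : ℕ) (v : ℤ → ℝ) (i : ℤ) : ℝ :=
  h ^ (-β) * ∑ j ∈ Icc (1 : ℤ) ((M : ℤ) - 1), gCoef β (i - j) * v j

theorem rpow_mul_sum_gCoef_eq_discreteRiesz {v : ℤ → ℝ} (hleft : v 0 = 0) (hright : v M = 0)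
    (i : ℤ) :
    h ^ (-β) * ∑ k ∈ Icc (i - (M : ℤ)) i, gCoef β k * v (i - k) = discreteRiesz β h M v i := by
  rw [discreteRiesz]
  congr 1
  calc ∑ k ∈ Icc (i - (M : ℤ)) i, gCoef β k * v (i - k)
      = ∑ j ∈ Icc (0 : ℤ) M, gCoef β (i - j) * v j :=
        sum_nbij' (i - ·) (i - ·) (by grind) (by grind) (by simp) (by simp) (by simp)
    _ = ∑ j ∈ Icc (1 : ℤ) ((M : ℤ) - 1), gCoef β (i - j) * v j := by
        refine (sum_subset (Icc_subset_Icc (by norm_num) (by omega)) fun j hj hj' => ?_).symm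
        simp only [mem_Icc] at hj hj'
        rcases (by omega : j = 0 ∨ j = M) with rfl | rfl
        · rw [hleft, mul_zero]
        · rw [hright, mul_zero]

theorem gridNorm_sq (hh : 0 ≤ h) (v : ℤ → ℝ) : gridNorm h M v ^ 2 = gridInner h M v v :=
  Real.sq_sqrt (mul_nonneg hh (sum_nonneg fun _ _ => mul_self_nonneg _))

theorem cStar_mul_gridNorm_sq_le_gridInner_discreteRiesz (hβ : β ∈ Set.Ioo 0 2) (hh : 0 ≤ h)
    (v : ℤ → ℝ) :
    cStar β * (2 * (M * h)) ^ (-β) * gridNorm h M v ^ 2 ≤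
      gridInner h M v (discreteRiesz β h M v) := by
  have hcoercive := mul_sum_sq_le_of_le_row_sum (s := Icc (1 : ℤ) ((M : ℤ) - 1))
    (a := fun i j => gCoef β (i - j)) (fun i _ j _ => by rw [← gCoef_neg, neg_sub])
    (fun i _ j _ hij => gCoef_nonpos hβ (sub_ne_zero.mpr hij))
    (fun i hi => cStar_mul_le_sum_gCoef_row hβ hi) v
  calc cStar β * (2 * (M * h)) ^ (-β) * gridNorm h M v ^ 2
      = h * h ^ (-β) * (cStar β * (2 * (M : ℝ)) ^ (-β) *
          ∑ i ∈ Icc (1 : ℤ) ((M : ℤ) - 1), v i ^ 2) := by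
        rw [gridNorm_sq hh, gridInner, ← mul_assoc 2, Real.mul_rpow (by positivity) hh]
        simp only [← sq]
        ring
    _ ≤ h * h ^ (-β) * ∑ i ∈ Icc (1 : ℤ) ((M : ℤ) - 1), v i *
          ∑ j ∈ Icc (1 : ℤ) ((M : ℤ) - 1), gCoef β (i - j) * v j :=
        mul_le_mul_of_nonneg_left hcoercive (mul_nonneg hh (Real.rpow_nonneg hh _))
    _ = gridInner h M v (discreteRiesz β h M v) := by
        rw [gridInner, mul_assoc, mul_sum]
        exact congrArg (h * ·) (sum_congr rfl fun i _ => by rw [discreteRiesz]; ring)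

end Coercivity

section Scheme

variable {ι : Type*} {s : Finset ι} {w α : ι → ℝ} {K β h τ σ T : ℝ} {M N : ℕ}

/-- The interior values of a grid function as a vector of Euclidean space, scaled so that
`gridInner` and `gridNorm` become the Euclidean inner product and norm. -/
noncomputable def gridVec (h : ℝ) (M : ℕ) :
    (ℤ → ℝ) →ₗ[ℝ] EuclideanSpace ℝ (Icc (1 : ℤ) ((M : ℤ) - 1)) :=
  √h • ((WithLp.linearEquiv 2 ℝ _).symm.toLinearMap ∘ₗ LinearMap.funLeft ℝ ℝ Subtype.val)

theorem gridVec_apply (h : ℝ) (M : ℕ) (v : ℤ → ℝ) (i : Icc (1 : ℤ) ((M : ℤ) - 1)) :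
    gridVec h M v i = √h * v i := rfl

theorem gridVec_congr {v v' : ℤ → ℝ} (hv : ∀ i : ℤ, 1 ≤ i → i ≤ (M : ℤ) - 1 → v i = v' i) :
    gridVec h M v = gridVec h M v' := by
  ext i
  obtain ⟨hi1, hiM⟩ := mem_Icc.mp i.2
  rw [gridVec_apply, gridVec_apply, hv i hi1 hiM]

theorem inner_gridVec (hh : 0 ≤ h) (v v' : ℤ → ℝ) :
    inner ℝ (gridVec h M v) (gridVec h M v') = gridInner h M v v' := by
  rw [PiLp.inner_apply, gridInner, mul_sum,
    ← sum_coe_sort (Icc (1 : ℤ) ((M : ℤ) - 1)) fun i => h * (v i * v' i)]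
  refine sum_congr rfl fun i _ => ?_
  rw [gridVec_apply, gridVec_apply, RCLike.inner_apply', conj_trivial,
    mul_mul_mul_comm, Real.mul_self_sqrt hh]

theorem norm_gridVec (hh : 0 ≤ h) (v : ℤ → ℝ) : ‖gridVec h M v‖ = gridNorm h M v := by
  rw [norm_eq_sqrt_real_inner, inner_gridVec hh, gridNorm]

/-- `u n i = u_i^n` solves, on time levels up to `N`, the difference scheme with zero boundary
values for `∑ r ∈ s, w_r D_t^{α_r} u = K ∂^β u / ∂|x|^β + F`; `F n` holds the samples of the source
at the shifted time `t_{n-1+σ}`. -/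
structure IsMultiTermSolution (s : Finset ι) (w α : ι → ℝ) (K β h τ σ : ℝ) (M N : ℕ)
    (F u : ℕ → ℤ → ℝ) : Prop where
  step : ∀ n : ℕ, 1 ≤ n → n ≤ N → ∀ i : ℤ, 1 ≤ i → i ≤ (M : ℤ) - 1 →
    ∑ k ∈ range n, multiTermCoef s w α τ σ n k * (u (n - k) i - u (n - k - 1) i) =
      -K * h ^ (-β) * ∑ k ∈ Icc (i - (M : ℤ)) i,
          gCoef β k * (σ * u n (i - k) + (1 - σ) * u (n - 1) (i - k)) +
        F n i
  boundary_left : ∀ n : ℕ, n ≤ N → u n 0 = 0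
  boundary_right : ∀ n : ℕ, n ≤ N → u n (M : ℤ) = 0

theorem IsMultiTermSolution.sum_smul_gridVec {F u : ℕ → ℤ → ℝ}
    (hu : IsMultiTermSolution s w α K β h τ σ M N F u) {m : ℕ} (hm : m < N) :
    ∑ k ∈ range (m + 1), multiTermCoef s w α τ σ (m + 1) k •
        (gridVec h M (u (m + 1 - k)) - gridVec h M (u (m + 1 - k - 1))) =
      gridVec h M (F (m + 1)) -
        K • gridVec h M (discreteRiesz β h M (σ • u (m + 1) + (1 - σ) • u m)) := by
  have hleft : (σ • u (m + 1) + (1 - σ) • u m) 0 = 0 := by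
    simp [hu.boundary_left (m + 1) hm, hu.boundary_left m hm.le]
  have hright : (σ • u (m + 1) + (1 - σ) • u m) M = 0 := by
    simp [hu.boundary_right (m + 1) hm, hu.boundary_right m hm.le]
  simp only [← map_smul, ← map_sub, ← map_sum]
  refine gridVec_congr fun i hi1 hiM => ?_
  have hstep := hu.step (m + 1) (by omega) hm i hi1 hiM
  simp only [Finset.sum_apply, Pi.smul_apply, Pi.sub_apply, smul_eq_mul,
    ← rpow_mul_sum_gCoef_eq_discreteRiesz hleft hright]
  rw [hstep, Nat.add_sub_cancel]
  simp only [Pi.add_apply, Pi.smul_apply, smul_eq_mul]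
  ring

theorem coercive_gridVec (hβ : β ∈ Set.Ioo 0 2) (hK : 0 ≤ K) (hh : 0 ≤ h) (v : ℤ → ℝ) :
    K * (cStar β * (2 * (M * h)) ^ (-β)) * ‖gridVec h M v‖ ^ 2 ≤
      inner ℝ (gridVec h M v) (K • gridVec h M (discreteRiesz β h M v)) := by
  rw [inner_smul_right, inner_gridVec hh, norm_gridVec hh, mul_assoc]
  exact mul_le_mul_of_nonneg_left (cStar_mul_gridNorm_sq_le_gridInner_discreteRiesz hβ hh v) hK

theorem IsMultiTermSolution.gridNorm_sq_le {F u : ℕ → ℤ → ℝ} {G : ℝ}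
    (hu : IsMultiTermSolution s w α K β h τ σ M N F u)
    (hw : ∀ r ∈ s, 0 ≤ w r) (hα : ∀ r ∈ s, α r ∈ Set.Icc 0 1)
    (hex : ∃ r ∈ s, α r < 1 ∧ 0 < w r) (hK : 0 < K) (hβ : β ∈ Set.Ioo 0 2)
    (hM : 1 ≤ M) (hh : 0 < h) (hτ : 0 < τ) (hT : 0 < T) (hNT : N * τ ≤ T)
    (hσ : σ ∈ Set.Icc (1 / 2) 1) (hroot : multiTermShiftFun s w α τ σ = 0)
    (hG : 0 ≤ G) (hF : ∀ m < N, gridNorm h M (F (m + 1)) ^ 2 ≤ G) :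
    gridNorm h M (u N) ^ 2 ≤ gridNorm h M (u 0) ^ 2 +
      (2 * (M * h)) ^ β / (K * cStar β * multiTermRate s w α T) * G := by
  have hrate := multiTermRate_pos hw (fun r hr => (hα r hr).2) hex hT
  have hcStar := cStar_pos hβ
  have hkernel (m : ℕ) (hm : m < N) : IsAlikhanovKernel σ (multiTermRate s w α T / 2) m
      (multiTermCoef s w α τ σ (m + 1)) := by
    have hmN : (m : ℝ) + 1 ≤ N := by exact_mod_cast hm
    exact isAlikhanovKernel_multiTermCoef hw hα hτ hσ hroot
      ((mul_le_mul_of_nonneg_right hmN hτ.le).trans hNT)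
  have hbound := norm_sq_le_of_isAlikhanovKernel (u := fun m => gridVec h M (u m))
    (F := fun m => gridVec h M (F (m + 1)))
    (D := fun m => K • gridVec h M (discreteRiesz β h M (σ • u (m + 1) + (1 - σ) • u m)))
    (κ := K * (cStar β * (2 * (M * h)) ^ (-β))) hσ.1 (half_pos hrate) (by positivity) hG hkernel
    (fun m hm => hu.sum_smul_gridVec hm)
    (fun m _ => by
      simpa only [map_add, map_smul] using
        coercive_gridVec hβ hK.le hh.le (σ • u (m + 1) + (1 - σ) • u m))
    (fun m hm => by simpa only [norm_gridVec hh.le] using hF m hm)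
  rw [norm_gridVec hh.le, norm_gridVec hh.le, Real.rpow_neg (by positivity)] at hbound
  refine hbound.trans_eq ?_
  field_simp

end Scheme

section TrapezoidNodes

variable {J r : ℕ}

theorem node_mem_Icc (hr : r ∈ range (2 * J + 1)) : node J r ∈ Set.Icc 0 1 := by
  have hrJ : (r : ℝ) ≤ 2 * J := by exact_mod_cast Nat.lt_succ_iff.mp (mem_range.mp hr)
  exact ⟨by unfold node; positivity, div_le_one_of_le₀ hrJ (by positivity)⟩

theorem node_lt_one (hr : r < 2 * J) : node J r < 1 := by
  have hrJ : (r : ℝ) < 2 * J := by exact_mod_cast hr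
  exact (div_lt_one ((Nat.cast_nonneg r).trans_lt hrJ)).mpr hrJ

theorem trapWeight_pos (J r : ℕ) : 0 < trapWeight J r := by
  unfold trapWeight
  split_ifs <;> norm_num

theorem lam_nonneg {ω : ℝ → ℝ} (hω : 0 ≤ ω (node J r)) : 0 ≤ lam ω J r :=
  mul_nonneg (mul_nonneg (trapWeight_pos J r).le hω) (by positivity)

theorem lam_pos {ω : ℝ → ℝ} (hJ : 1 ≤ J) (hω : 0 < ω (node J r)) : 0 < lam ω J r :=
  mul_pos (mul_pos (trapWeight_pos J r) hω) (by positivity)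

theorem exists_node_lt_one_and_lam_pos {ω : ℝ → ℝ} (hJ : 1 ≤ J)
    (hω : ∃ r : ℕ, r < 2 * J ∧ 0 < ω (node J r)) :
    ∃ r ∈ range (2 * J + 1), node J r < 1 ∧ 0 < lam ω J r := by
  obtain ⟨r, hr, hωr⟩ := hω
  exact ⟨r, mem_range.mpr (by omega), node_lt_one hr, lam_pos hJ hωr⟩

theorem natCast_mul_div_natCast_le {T : ℝ} {n N : ℕ} (hT : 0 ≤ T) (hnN : n ≤ N) :
    n * (T / N) ≤ T := by
  rw [mul_div_left_comm]
  exact mul_le_of_le_one_right hT (div_le_one_of_le₀ (by exact_mod_cast hnN) N.cast_nonneg)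

theorem IsSchemeSolution.isMultiTermSolution {ω φ : ℝ → ℝ} {f : ℝ → ℝ → ℝ} {L T K β σ : ℝ}
    {M N n : ℕ} {u : ℕ → ℤ → ℝ} (hu : IsSchemeSolution ω φ f L T K β J M N σ u) (hn : n ≤ N) :
    IsMultiTermSolution (range (2 * J + 1)) (lam ω J) (node J) K β (L / M) (T / N) σ M n
      (sourceGrid f (L / M) (T / N) σ) u where
  step m hm hmn := hu.step m hm (hmn.trans hn)
  boundary_left m hmn := hu.boundary_left m (hmn.trans hn)
  boundary_right m hmn := hu.boundary_right m (hmn.trans hn)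

end TrapezoidNodes

end DistRiesz

theorem mainTheorem2_general {ι : Type*} {s : Finset ι} {w α : ι → ℝ} {K β h τ σ T : ℝ} {M N : ℕ}
    {F u : ℕ → ℤ → ℝ} (hw : ∀ r ∈ s, 0 ≤ w r) (hα : ∀ r ∈ s, α r ∈ Set.Icc 0 1)
    (hex : ∃ r ∈ s, α r < 1 ∧ 0 < w r) (hK : 0 < K) (hβ : β ∈ Set.Ioo 0 2)
    (hM : 1 ≤ M) (hh : 0 < h) (hN : 1 ≤ N) (hτ : 0 < τ) (hNT : N * τ ≤ T)
    (hσ : σ ∈ Set.Icc (1 / 2) 1) (hroot : DistRiesz.multiTermShiftFun s w α τ σ = 0)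
    (hu : DistRiesz.IsMultiTermSolution s w α K β h τ σ M N F u) :
    DistRiesz.gridNorm h M (u N) ^ 2 ≤
      DistRiesz.gridNorm h M (u 0) ^ 2 +
        (2 * (M * h)) ^ β / (K * DistRiesz.cStar β * DistRiesz.multiTermRate s w α T) *
          (Finset.Icc 1 N).sup' (Finset.nonempty_Icc.mpr hN)
            (fun l => DistRiesz.gridNorm h M (F l) ^ 2) := by
  have hsource (l : ℕ) (hl : l ∈ Finset.Icc 1 N) :=
    Finset.le_sup' (fun l => DistRiesz.gridNorm h M (F l) ^ 2) hl
  exact hu.gridNorm_sq_le hw hα hex hK hβ hM hh hτ ((by positivity : 0 < N * τ).trans_le hNT) hNT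
    hσ hroot ((sq_nonneg _).trans (hsource N (Finset.right_mem_Icc.mpr hN)))
    fun m hm => hsource (m + 1) (Finset.mem_Icc.mpr ⟨by omega, hm⟩)

theorem mainTheorem2 (L T K β : ℝ) (hL : 0 < L) (hT : 0 < T) (hK : 0 < K)
    (hβ1 : 1 < β) (hβ2 : β < 2)
    (J M N : ℕ) (hJ : 1 ≤ J) (hM : 1 ≤ M) (hN : 1 ≤ N)
    (ω : ℝ → ℝ) (hω : ∀ α ∈ Set.Icc (0 : ℝ) 1, 0 ≤ ω α)
    (hωpos : ∃ r : ℕ, r < 2 * J ∧ 0 < ω (DistRiesz.node J r))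
    (φ : ℝ → ℝ) (f : ℝ → ℝ → ℝ)
    (σ : ℝ) (hσ : σ ∈ Set.Icc (1 / 2 : ℝ) 1)
    (hσroot : DistRiesz.shiftFun ω J (T / N) σ = 0)
    (u : ℕ → ℤ → ℝ)
    (hu : DistRiesz.IsSchemeSolution ω φ f L T K β J M N σ u)
    (n : ℕ) (hn : 1 ≤ n) (hnN : n ≤ N) :
    DistRiesz.gridNorm (L / M) M (u n) ^ 2 ≤
      DistRiesz.gridNorm (L / M) M (u 0) ^ 2 +
        (2 * L) ^ β /
            (K * DistRiesz.cStar β *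
              ∑ r ∈ Finset.range (2 * J + 1),
                DistRiesz.lam ω J r /
                  (T ^ DistRiesz.node J r * Real.Gamma (1 - DistRiesz.node J r))) *
          (Finset.Icc 1 n).sup' (Finset.nonempty_Icc.mpr hn)
            (fun l => DistRiesz.gridNorm (L / M) M
              (DistRiesz.sourceGrid f (L / M) (T / N) σ l) ^ 2) := by
  have hgeneral := mainTheorem2_general
    (fun _ hr => DistRiesz.lam_nonneg (hω _ (DistRiesz.node_mem_Icc hr)))
    (fun _ hr => DistRiesz.node_mem_Icc hr) (DistRiesz.exists_node_lt_one_and_lam_pos hJ hωpos)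
    hK ⟨by linarith, hβ2⟩ hM (div_pos hL (by positivity)) hn (div_pos hT (by positivity))
    (DistRiesz.natCast_mul_div_natCast_le hT.le hnN) hσ hσroot (hu.isMultiTermSolution hnN)
  rwa [mul_div_cancel₀ L (by positivity)] at hgeneral
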